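/- Let $X$ and $Y$ be random vectors in $\mathbb{R}^{d_X}$ and $\mathbb{R}^{d_Y}$ with an arbitrary joint distribution $P_{X,Y}$, and let $\varphi_X(\alpha)$, $\varphi_Y(\beta)$ and $\varphi_{X,Y}(\gamma)$, $\gamma=(\alpha,\beta)\in\mathbb{R}^{d_X+d_Y}$, be the characteristic functions of $X$, $Y$ and $(X,Y)$. Put $$\kappa(X,Y)=\sup_{\alpha,\beta}\bigl|\varphi_{X,Y}(\alpha,\beta)-\varphi_X(\alpha)\varphi_Y(\beta)\bigr| .$$ Let $(x_j,y_j)$, $j=1,2,\dots$, be i.i.d. observations with distribution $P_{X,Y}$, and let $$\varphi_n(\alpha)=\tfrac1n\sum_{j=1}^n e^{i\langle\alpha,x_j\rangle},\qquad \varphi_n(\beta)=\tfrac1n\sum_{j=1}^n e^{i\langle\beta,y_j\rangle},\qquad \varphi_n(\alpha,\beta)=\tfrac1n\sum_{j=1}^n e^{i(\langle\alpha,x_j\rangle+\langle\beta,y_j\rangle)}$$ be the empirical characteristic functions. Let $\xi_X,\xi_Y,\xi_{X,Y}$ be characteristic functions of distributions on $\mathbb{R}^{d_X},\mathbb{R}^{d_Y},\mathbb{R}^{d_X+d_Y}$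 that have densities with respect to Lebesgue measure (e.g. the standard Gaussian ones). For $h>0$ define the smoothed estimator $$\widetilde\kappa_n(X^n,Y^n,h)=\sup_{\alpha,\beta}\bigl|\varphi_n(\alpha,\beta)\,\xi_{X,Y}(h\alpha,h\beta)-\varphi_n(\alpha)\xi_X(h\alpha)\,\varphi_n(\beta)\xi_Y(h\beta)\bigr| .$$ Suppose that either the smoothing functions are compatible, $\xi_{X,Y}(\alpha,\beta)=\xi_X(\alpha)\xi_Y(\beta)$ for all $\alpha,\beta$ (as for the standard Gaussian), or $\varphi_{X,Y}(\gamma)\to0$ as $\|\gamma\|\to\infty$ (as when $(X,Y)$ has a density). If $h_n>0$, $\lim_{n\to\infty}h_n=0$ and $\lim_{n\to\infty}\frac{\log h_n}{n}=0$, then $$\lim_{n\to\infty}\bigl|\kappa(X,Y)-\widetilde\kappa_n(X^n,Y^n,h_n)\bigr|=0\quad\text{almost surely.}$$ -/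

import Mathlib

open MeasureTheory ProbabilityTheory Filter Topology

/-- The column vector `γ = (αᵀ, βᵀ)ᵀ` in `ℝ^{d_X + d_Y}`, the Euclidean (`L²`) product of the
two Euclidean spaces. -/
def joinVec {dX dY : ℕ} (α : EuclideanSpace ℝ (Fin dX)) (β : EuclideanSpace ℝ (Fin dY)) :
    WithLp 2 (EuclideanSpace ℝ (Fin dX) × EuclideanSpace ℝ (Fin dY)) :=
  WithLp.toLp 2 (α, β)

/-- The characteristic function `t ↦ E exp(i ⟨t, Z⟩)` of a random vector `Z`. -/
noncomputable def cf {Ω E : Type*} [MeasurableSpace Ω] [NormedAddCommGroup E]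
    [InnerProductSpace ℝ E] [MeasurableSpace E] (P : Measure Ω) (Z : Ω → E) (t : E) : ℂ :=
  charFun (P.map Z) t

/-- `Δ(α, β) = φ_{X,Y}(α, β) - φ_X(α) φ_Y(β)`. -/
noncomputable def kacDelta {Ω : Type*} [MeasurableSpace Ω] {dX dY : ℕ} (P : Measure Ω)
    (X : Ω → EuclideanSpace ℝ (Fin dX)) (Y : Ω → EuclideanSpace ℝ (Fin dY))
    (α : EuclideanSpace ℝ (Fin dX)) (β : EuclideanSpace ℝ (Fin dY)) : ℂ :=
  cf P (fun ω => joinVec (X ω) (Y ω)) (joinVec α β) - cf P X α * cf P Y β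

/-- The Kac independence measure `κ(X, Y) = sup_{α, β} |Δ(α, β)|`. -/
noncomputable def kacIM {Ω : Type*} [MeasurableSpace Ω] {dX dY : ℕ} (P : Measure Ω)
    (X : Ω → EuclideanSpace ℝ (Fin dX)) (Y : Ω → EuclideanSpace ℝ (Fin dY)) : ℝ :=
  ⨆ p : EuclideanSpace ℝ (Fin dX) × EuclideanSpace ℝ (Fin dY), ‖kacDelta P X Y p.1 p.2‖

/-- The empirical characteristic function `φ_n(t) = (1/n) ∑_{j<n} exp(i ⟨t, z_j⟩)` of the first
`n` terms of a sequence of observations. -/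
noncomputable def ecf {E : Type*} [NormedAddCommGroup E] [InnerProductSpace ℝ E]
    (n : ℕ) (z : ℕ → E) (t : E) : ℂ :=
  (1 / (n : ℂ)) * ∑ j ∈ Finset.range n, Complex.exp (((inner ℝ t (z j) : ℝ) : ℂ) * Complex.I)

/-- The smoothed empirical characteristic function `φ_n(t) ξ(h t)`. -/
noncomputable def smoothedEcf {E : Type*} [NormedAddCommGroup E] [InnerProductSpace ℝ E]
    (ξ : E → ℂ) (n : ℕ) (z : ℕ → E) (h : ℝ) (t : E) : ℂ :=
  ecf n z t * ξ (h • t)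

/-- `ξ` is the characteristic function of a continuous distribution, that is, of a probability
measure with a density with respect to Lebesgue measure. -/
def IsContinuousCF {E : Type*} [NormedAddCommGroup E] [InnerProductSpace ℝ E]
    [FiniteDimensional ℝ E] [MeasurableSpace E] [BorelSpace E] (ξ : E → ℂ) : Prop :=
  ∃ μ : Measure E, IsProbabilityMeasure μ ∧ μ ≪ volume ∧ ξ = charFun μ

/-- The smoothed empirical `Δ`, that is, the smoothed joint empirical characteristic function minus
the product of the smoothed marginal ones; `ξX`, `ξY`, `ξXY` are the smoothing characteristic
functions in the dimensions `d_X`, `d_Y`, `d_X + d_Y`. -/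
noncomputable def smoothedDelta {dX dY : ℕ}
    (ξX : EuclideanSpace ℝ (Fin dX) → ℂ) (ξY : EuclideanSpace ℝ (Fin dY) → ℂ)
    (ξXY : WithLp 2 (EuclideanSpace ℝ (Fin dX) × EuclideanSpace ℝ (Fin dY)) → ℂ)
    (n : ℕ) (x : ℕ → EuclideanSpace ℝ (Fin dX)) (y : ℕ → EuclideanSpace ℝ (Fin dY)) (h : ℝ)
    (α : EuclideanSpace ℝ (Fin dX)) (β : EuclideanSpace ℝ (Fin dY)) : ℂ :=
  smoothedEcf ξXY n (fun j => joinVec (x j) (y j)) h (joinVec α β)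
    - smoothedEcf ξX n x h α * smoothedEcf ξY n y h β

/-- The smoothed estimator of the Kac independence measure, the supremum norm of the smoothed
empirical `Δ`. -/
noncomputable def smoothedKacIM {dX dY : ℕ}
    (ξX : EuclideanSpace ℝ (Fin dX) → ℂ) (ξY : EuclideanSpace ℝ (Fin dY) → ℂ)
    (ξXY : WithLp 2 (EuclideanSpace ℝ (Fin dX) × EuclideanSpace ℝ (Fin dY)) → ℂ)
    (n : ℕ) (x : ℕ → EuclideanSpace ℝ (Fin dX)) (y : ℕ → EuclideanSpace ℝ (Fin dY))
    (h : ℝ) : ℝ :=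
  ⨆ p : EuclideanSpace ℝ (Fin dX) × EuclideanSpace ℝ (Fin dY),
    ‖smoothedDelta ξX ξY ξXY n x y h p.1 p.2‖

/-! ### Moduli of continuity, the Riemann-Lebesgue lemma and finite nets -/

section Analysis

variable {E : Type*} [NormedAddCommGroup E] [InnerProductSpace ℝ E]

/-! Two scales of frequency are treated separately. On balls of radius `R / h n` the empirical
characteristic functions converge uniformly. Hoeffding's inequality gives exponentially small
failure at one frequency. A δ-net of a ball of radius `T` has `O(T ^ d)` points, so a union bound
and Borel-Cantelli survive up to radius `exp (η * n)` for a small `η`. Since `log (h n) / n → 0`,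
that radius eventually exceeds `R / h n`. Between net points, the strong law for the truncated
modulus `min 2 (δ * ‖z‖)` controls oscillation without any moment assumption. Beyond `R / h n` the
factor `ξ (h n • t)` is small by Riemann-Lebesgue, since `ξ` comes from a density.

With compatible smoothing, `ξXY (h n • γ)` factors out of the smoothed empirical Δ, which is thus
uniformly close to `ξXY (h n • γ) * Δ γ`. This need not be uniformly close to Δ, but the suprema
still agree in the limit: `‖ξXY‖ ≤ 1` bounds the estimator from above, and `ξXY (h n • γ) → 1` at
each fixed γ bounds it from below. If instead the joint characteristic function vanishes at
infinity, so do its marginals, and each smoothed empirical characteristic function converges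
uniformly to its limit. -/

lemma norm_exp_ofReal_mul_I_sub_le (a b : ℝ) :
    ‖Complex.exp (a * Complex.I) - Complex.exp (b * Complex.I)‖ ≤ min 2 |a - b| := by
  refine le_min ?_ ?_
  · refine (norm_sub_le _ _).trans ?_
    rw [Complex.norm_exp_ofReal_mul_I, Complex.norm_exp_ofReal_mul_I]
    norm_num
  · have h : Complex.exp (a * Complex.I) - Complex.exp (b * Complex.I) =
        Complex.exp (b * Complex.I) * (Complex.exp (Complex.I * ((a - b : ℝ) : ℂ)) - 1) := by
      rw [mul_sub, ← Complex.exp_add, mul_one]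
      congr 2
      push_cast
      ring
    rw [h, norm_mul, Complex.norm_exp_ofReal_mul_I, one_mul]
    exact Real.norm_exp_I_mul_ofReal_sub_one_le

/-- The cap at 2 keeps the bound integrable under every law of `z`, and the bound depends on `t`,
`u` only through `δ`. -/
lemma norm_exp_inner_sub_le {t u : E} {δ : ℝ} (htu : ‖t - u‖ ≤ δ) (z : E) :
    ‖Complex.exp (((inner ℝ t z : ℝ) : ℂ) * Complex.I) -
      Complex.exp (((inner ℝ u z : ℝ) : ℂ) * Complex.I)‖ ≤ min 2 (δ * ‖z‖) := by
  refine (norm_exp_ofReal_mul_I_sub_le _ _).trans (min_le_min le_rfl ?_)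
  rw [← inner_sub_left]
  exact (abs_real_inner_le_norm _ _).trans (by gcongr)

lemma norm_ecf_le_one (n : ℕ) (z : ℕ → E) (t : E) : ‖ecf n z t‖ ≤ 1 := by
  rw [ecf, norm_mul]
  have h : ‖∑ j ∈ Finset.range n, Complex.exp (((inner ℝ t (z j) : ℝ) : ℂ) * Complex.I)‖ ≤ n := by
    refine (norm_sum_le _ _).trans ?_
    simp [Complex.norm_exp_ofReal_mul_I]
  rcases n.eq_zero_or_pos with rfl | hn
  · simp
  · rw [norm_div, norm_one, Complex.norm_natCast, one_div]
    have : (0 : ℝ) < n := by exact_mod_cast hn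
    calc (n : ℝ)⁻¹ * _ ≤ (n : ℝ)⁻¹ * n := by gcongr
      _ = 1 := inv_mul_cancel₀ this.ne'

lemma norm_ecf_sub_le {t u : E} {δ : ℝ} (htu : ‖t - u‖ ≤ δ) (n : ℕ) (z : ℕ → E) :
    ‖ecf n z t - ecf n z u‖ ≤ (∑ j ∈ Finset.range n, min 2 (δ * ‖z j‖)) / n := by
  rw [ecf, ecf, ← mul_sub, ← Finset.sum_sub_distrib, norm_mul, norm_div, norm_one,
    Complex.norm_natCast, one_div_mul_eq_div]
  gcongr
  exact (norm_sum_le _ _).trans (Finset.sum_le_sum fun j _ => norm_exp_inner_sub_le htu _)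

lemma ecf_re (n : ℕ) (z : ℕ → E) (t : E) :
    (ecf n z t).re = (∑ j ∈ Finset.range n, Real.cos (inner ℝ t (z j))) / n := by
  rw [ecf, show (1 / (n : ℂ)) = ((1 / (n : ℝ) : ℝ) : ℂ) by push_cast; rfl, Complex.re_ofReal_mul,
    Complex.re_sum]
  simp only [Complex.exp_ofReal_mul_I_re]
  ring

lemma ecf_im (n : ℕ) (z : ℕ → E) (t : E) :
    (ecf n z t).im = (∑ j ∈ Finset.range n, Real.sin (inner ℝ t (z j))) / n := by
  rw [ecf, show (1 / (n : ℂ)) = ((1 / (n : ℝ) : ℝ) : ℂ) by push_cast; rfl, Complex.im_ofReal_mul,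
    Complex.im_sum]
  simp only [Complex.exp_ofReal_mul_I_im]
  ring

variable [MeasurableSpace E]

lemma charFun_eq_integral_exp_inner (μ : Measure E) (t : E) :
    charFun μ t = ∫ z, Complex.exp (((inner ℝ t z : ℝ) : ℂ) * Complex.I) ∂μ := by
  simp_rw [charFun_apply, real_inner_comm]

variable [BorelSpace E]

lemma integrable_exp_inner (μ : Measure E) [IsFiniteMeasure μ] (t : E) :
    Integrable (fun z => Complex.exp (((inner ℝ t z : ℝ) : ℂ) * Complex.I)) μ := by
  refine Integrable.of_bound (C := 1) ?_ ?_
  · exact Continuous.aestronglyMeasurable (by fun_prop)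
  · simp [Complex.norm_exp_ofReal_mul_I]

lemma integrable_min_two_mul_norm {F : Type*} [NormedAddCommGroup F] [MeasurableSpace F]
    [BorelSpace F] (μ : Measure F) [IsFiniteMeasure μ] {δ : ℝ} (hδ : 0 ≤ δ) :
    Integrable (fun z : F => min 2 (δ * ‖z‖)) μ := by
  refine Integrable.of_bound (C := 2) ?_ (.of_forall fun z => ?_)
  · exact Continuous.aestronglyMeasurable (by fun_prop)
  · rw [Real.norm_of_nonneg (by positivity)]
    exact min_le_left _ _

/-- Dominated convergence along `δ = 1 / (k + 1)`; this fixes the mesh of the net. -/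
lemma exists_integral_min_two_mul_norm_lt {F : Type*} [NormedAddCommGroup F] [MeasurableSpace F]
    [BorelSpace F] (μ : Measure F) [IsFiniteMeasure μ]
    {ε : ℝ} (hε : 0 < ε) : ∃ δ > 0, ∫ z, min 2 (δ * ‖z‖) ∂μ < ε := by
  have h : Tendsto (fun k : ℕ => ∫ z, min 2 (1 / ((k : ℝ) + 1) * ‖z‖) ∂μ) atTop
      (𝓝 (∫ _, 0 ∂μ)) := by
    refine tendsto_integral_of_dominated_convergence (fun _ => 2) (fun k => ?_)
      (integrable_const _) (fun k => .of_forall fun z => ?_) (.of_forall fun z => ?_)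
    · exact Continuous.aestronglyMeasurable (by fun_prop)
    · rw [Real.norm_of_nonneg (by positivity)]
      exact min_le_left _ _
    · have h1 := (tendsto_one_div_add_atTop_nhds_zero_nat (𝕜 := ℝ)).mul_const ‖z‖
      simpa using (tendsto_const_nhds (x := (2 : ℝ))).min h1
  rw [integral_zero] at h
  obtain ⟨k, hk⟩ := (h.eventually (gt_mem_nhds hε)).exists
  exact ⟨1 / (k + 1), by positivity, hk⟩

lemma charFun_re (μ : Measure E) [IsFiniteMeasure μ] (t : E) :
    (charFun μ t).re = ∫ z, Real.cos (inner ℝ t z) ∂μ := by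
  rw [charFun_eq_integral_exp_inner]
  refine (integral_re (integrable_exp_inner μ t)).symm.trans ?_
  simp [Complex.exp_ofReal_mul_I_re]

lemma charFun_im (μ : Measure E) [IsFiniteMeasure μ] (t : E) :
    (charFun μ t).im = ∫ z, Real.sin (inner ℝ t z) ∂μ := by
  rw [charFun_eq_integral_exp_inner]
  refine (integral_im (integrable_exp_inner μ t)).symm.trans ?_
  simp [Complex.exp_ofReal_mul_I_im]

lemma norm_charFun_sub_le (μ : Measure E) [IsFiniteMeasure μ] {t u : E} {δ : ℝ}
    (htu : ‖t - u‖ ≤ δ) :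
    ‖charFun μ t - charFun μ u‖ ≤ ∫ z, min 2 (δ * ‖z‖) ∂μ := by
  have hδ : 0 ≤ δ := (norm_nonneg _).trans htu
  rw [charFun_eq_integral_exp_inner, charFun_eq_integral_exp_inner,
    ← integral_sub (integrable_exp_inner μ t) (integrable_exp_inner μ u)]
  exact norm_integral_le_of_norm_le (integrable_min_two_mul_norm μ hδ)
    (.of_forall fun z => norm_exp_inner_sub_le htu z)

variable [FiniteDimensional ℝ E]

/-- The **Riemann-Lebesgue lemma** for characteristic functions. -/
lemma tendsto_charFun_cocompact (μ : Measure E) [IsFiniteMeasure μ] (hμ : μ ≪ volume) :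
    Tendsto (charFun μ) (cocompact E) (𝓝 0) := by
  have h := tendsto_integral_exp_inner_smul_cocompact
    (fun v : E => (((μ.rnDeriv volume v).toReal : ℝ) : ℂ))
  -- Rescaling the frequency by this constant turns the kernel `exp (-2πi⟨v, w⟩)` into `exp (i⟨v,
  -- t⟩)`.
  have hc : (-(2 * Real.pi)⁻¹ : ℝ) ≠ 0 := by simp [Real.pi_ne_zero]
  have h2 := h.comp (Homeomorph.smulOfNeZero (α := E) _ hc).isClosedEmbedding.tendsto_cocompact
  refine h2.congr fun t => ?_
  rw [charFun_apply, ← integral_rnDeriv_smul hμ]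
  refine integral_congr_ae (.of_forall fun v => ?_)
  simp only [Circle.smul_def, Real.fourierChar_apply, Homeomorph.smulOfNeZero_apply,
    inner_smul_right, smul_eq_mul, Complex.real_smul]
  rw [mul_comm]
  congr 2
  push_cast
  field_simp

/-- A cubic grid in an orthonormal basis. What matters is growth polynomial in `T`, with `C`
independent of `T`. -/
lemma exists_finset_cover_closedBall (E : Type*) [NormedAddCommGroup E] [InnerProductSpace ℝ E]
    [FiniteDimensional ℝ E] {δ : ℝ} (hδ : 0 < δ) :
    ∃ C : ℝ, 0 ≤ C ∧ ∀ T : ℝ, 1 ≤ T → ∃ s : Finset E,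
      (s.card : ℝ) ≤ C * T ^ Module.finrank ℝ E ∧ ∀ t : E, ‖t‖ ≤ T → ∃ u ∈ s, ‖t - u‖ ≤ δ := by
  classical
  set d := Module.finrank ℝ E with hd
  set b := stdOrthonormalBasis ℝ E
  -- Rounding `d` coordinates down costs at most `d * η ≤ δ`; the `+ 1` also covers `d = 0`.
  set η : ℝ := δ / (d + 1) with hη
  have hη0 : 0 < η := by positivity
  refine ⟨(2 / η + 3) ^ d, by positivity, fun T hT => ?_⟩
  set M : ℕ := ⌈T / η⌉₊
  have hM : (M : ℝ) < T / η + 1 := Nat.ceil_lt_add_one (by positivity)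
  have hM' : T / η ≤ M := Nat.le_ceil _
  refine ⟨(Fintype.piFinset fun _ : Fin d => Finset.Icc (-(M : ℤ)) M).image
    fun k => ∑ i, ((k i : ℝ) * η) • b i, ?_, fun t ht => ?_⟩
  -- `2 * M + 1 < 2 * T / η + 3`, and `1 ≤ T` absorbs the 3.
  · have h1 : ((2 * M + 1 : ℕ) : ℝ) ≤ (2 / η + 3) * T := by
      push_cast
      have : 2 / η * T = 2 * (T / η) := by ring
      nlinarith
    calc _ ≤ (((Fintype.piFinset fun _ : Fin d => Finset.Icc (-(M : ℤ)) M).card : ℕ) : ℝ) := by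
          exact_mod_cast Finset.card_image_le
      _ = ((2 * M + 1 : ℕ) : ℝ) ^ d := by
          rw [Fintype.card_piFinset_const, Int.card_Icc]
          have : ((M : ℤ) + 1 - -(M : ℤ)).toNat = 2 * M + 1 := by omega
          rw [this, Nat.cast_pow]
      _ ≤ ((2 / η + 3) * T) ^ d := by gcongr
      _ = _ := mul_pow _ _ _
  · refine ⟨_, Finset.mem_image_of_mem _ (a := fun i => ⌊inner ℝ (b i) t / η⌋) ?_, ?_⟩
    · rw [Fintype.mem_piFinset]
      intro i
      have hi : |inner ℝ (b i) t| ≤ T :=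
        (abs_real_inner_le_norm _ _).trans (by simpa using ht)
      have h1 : |inner ℝ (b i) t / η| ≤ M := by
        rw [abs_div, abs_of_pos hη0]
        exact (by gcongr : _ ≤ T / η).trans hM'
      rw [abs_le] at h1
      rw [Finset.mem_Icc]
      constructor
      · rw [Int.le_floor]
        push_cast
        exact h1.1
      · have := (Int.floor_le (inner ℝ (b i) t / η)).trans h1.2
        exact_mod_cast this
    · have h2 : t - ∑ i, ((⌊inner ℝ (b i) t / η⌋ : ℝ) * η) • b i =
          ∑ i, (inner ℝ (b i) t - (⌊inner ℝ (b i) t / η⌋ : ℝ) * η) • b i := by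
        simp_rw [sub_smul, Finset.sum_sub_distrib, b.sum_repr' t]
      rw [h2]
      calc _ ≤ ∑ i : Fin d, ‖(inner ℝ (b i) t - (⌊inner ℝ (b i) t / η⌋ : ℝ) * η) • b i‖ :=
            norm_sum_le _ _
        _ ≤ ∑ _i : Fin d, η := by
            refine Finset.sum_le_sum fun i _ => ?_
            rw [norm_smul, b.norm_eq_one, mul_one, Real.norm_eq_abs, abs_le]
            have h3 := Int.floor_le (inner ℝ (b i) t / η)
            have h4 := Int.lt_floor_add_one (inner ℝ (b i) t / η)
            rw [le_div_iff₀ hη0] at h3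
            rw [div_lt_iff₀ hη0] at h4
            constructor <;> nlinarith
        _ = d * η := by simp
        _ ≤ δ := by
            rw [hη, mul_div_assoc', div_le_iff₀ (by positivity)]
            nlinarith

end Analysis

/-! ### Hoeffding bounds and uniform convergence on growing balls -/

section Concentration

variable {Ω : Type*} [MeasurableSpace Ω] {P : Measure Ω} [IsProbabilityMeasure P]

/-- **Hoeffding's inequality** for the empirical mean of independent variables in `[-1, 1]`. -/
lemma measureReal_abs_mean_sub_ge_le {W : ℕ → Ω → ℝ} {m ε : ℝ} (hW : ∀ j, AEMeasurable (W j) P)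
    (hind : iIndepFun W P) (hb : ∀ j ω, W j ω ∈ Set.Icc (-1 : ℝ) 1) (hm : ∀ j, P[W j] = m)
    (hε : 0 ≤ ε) (n : ℕ) (hn : 0 < n) :
    P.real {ω | ε ≤ |(∑ j ∈ Finset.range n, W j ω) / n - m|} ≤
      2 * Real.exp (-(ε ^ 2 / 2 * n)) := by
  have hn' : (0 : ℝ) < n := by exact_mod_cast hn
  -- The parameter is the squared half-length of `[-1, 1]`.
  have hsub : ∀ j, HasSubgaussianMGF (fun ω => W j ω - m) 1 P := fun j => by
    have h := hasSubgaussianMGF_of_mem_Icc (hW j) (.of_forall (hb j))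
    rw [hm j] at h
    convert h
    ext
    norm_num
  have hind' : iIndepFun (fun j ω => W j ω - m) P :=
    hind.comp (fun _ x => x - m) fun _ => by fun_prop
  have hind'' : iIndepFun (fun j ω => -(W j ω - m)) P :=
    hind.comp (fun _ x => -(x - m)) fun _ => by fun_prop
  have h1 := HasSubgaussianMGF.measure_sum_range_ge_le_of_iIndepFun hind' (n := n)
    (fun j _ => hsub j) (ε := ε * n) (by positivity)
  have h2 := HasSubgaussianMGF.measure_sum_range_ge_le_of_iIndepFun hind'' (n := n)
    (fun j _ => (hsub j).neg) (ε := ε * n) (by positivity)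
  have he : -(ε * n) ^ 2 / (2 * n * ((1 : NNReal) : ℝ)) = -(ε ^ 2 / 2 * n) := by
    push_cast
    field_simp
  rw [he] at h1 h2
  calc _ ≤ P.real ({ω | ε * n ≤ ∑ i ∈ Finset.range n, (W i ω - m)} ∪
          {ω | ε * n ≤ ∑ i ∈ Finset.range n, -(W i ω - m)}) := by
        refine measureReal_mono fun ω hω => ?_
        simp only [Set.mem_ofPred_eq, Set.mem_union, Finset.sum_neg_distrib, Finset.sum_sub_distrib,
          Finset.sum_const, Finset.card_range, nsmul_eq_mul] at hω ⊢
        have h3 : (∑ j ∈ Finset.range n, W j ω) / n - m =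
            (∑ j ∈ Finset.range n, W j ω - n * m) / n := by field_simp
        rw [h3, abs_div, abs_of_pos hn', le_div_iff₀ hn'] at hω
        exact le_abs.1 hω
    _ ≤ _ := measureReal_union_le _ _
    _ ≤ _ := by linarith

variable {E : Type*} [NormedAddCommGroup E] [InnerProductSpace ℝ E] [MeasurableSpace E]
  [BorelSpace E] {μ : Measure E} [IsProbabilityMeasure μ] {Z : ℕ → Ω → E}

/-- A complex deviation of size `ε` forces one of size `ε / 2` in the real or the imaginary part, so
two real Hoeffding bounds suffice. -/
lemma measureReal_norm_ecf_sub_charFun_ge_le (hZ : ∀ j, AEMeasurable (Z j) P)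
    (hind : iIndepFun Z P) (hlaw : ∀ j, P.map (Z j) = μ) {ε : ℝ} (hε : 0 ≤ ε) (t : E) (n : ℕ)
    (hn : 0 < n) :
    P.real {ω | ε ≤ ‖ecf n (fun j => Z j ω) t - charFun μ t‖} ≤
      4 * Real.exp (-(ε ^ 2 / 8 * n)) := by
  have key : ∀ g : ℝ → ℝ, Continuous g → (∀ x, g x ∈ Set.Icc (-1 : ℝ) 1) →
      P.real {ω | ε / 2 ≤ |(∑ j ∈ Finset.range n, g (inner ℝ t (Z j ω))) / n -
        ∫ z, g (inner ℝ t z) ∂μ|} ≤ 2 * Real.exp (-((ε / 2) ^ 2 / 2 * n)) := by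
    intro g hg hgb
    have hc : Continuous fun z : E => g (inner ℝ t z) := by fun_prop
    refine measureReal_abs_mean_sub_ge_le (fun j => hc.measurable.comp_aemeasurable (hZ j))
      (hind.comp (fun _ z => g (inner ℝ t z)) fun _ => hc.measurable) (fun j ω => hgb _)
      (fun j => ?_) (by positivity) n hn
    rw [← hlaw j, integral_map (hZ j) hc.aestronglyMeasurable]
    rfl
  have h1 := key Real.cos Real.continuous_cos fun x => ⟨Real.neg_one_le_cos x, Real.cos_le_one x⟩
  have h2 := key Real.sin Real.continuous_sin fun x => ⟨Real.neg_one_le_sin x, Real.sin_le_one x⟩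
  rw [show (ε / 2) ^ 2 / 2 = ε ^ 2 / 8 by ring] at h1 h2
  refine (measureReal_mono (fun ω hω => ?_) |>.trans (measureReal_union_le _ _)).trans
    ((add_le_add h1 h2).trans (by linarith))
  simp only [Set.mem_ofPred_eq, Set.mem_union] at hω ⊢
  rw [← ecf_re n (fun j => Z j ω) t, ← ecf_im n (fun j => Z j ω) t, ← charFun_re, ← charFun_im,
    ← Complex.sub_re, ← Complex.sub_im]
  by_contra! hcon
  have := Complex.norm_le_abs_re_add_abs_im (ecf n (fun j => Z j ω) t - charFun μ t)
  linarith [hcon.1, hcon.2]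

variable [FiniteDimensional ℝ E]

/-- Uniform convergence of the empirical characteristic function over balls whose radius grows
exponentially, up to a fixed error. -/
lemma exists_rate_ae_eventually_norm_ecf_sub_charFun_le (hZ : ∀ j, AEMeasurable (Z j) P)
    (hind : iIndepFun Z P) (hlaw : ∀ j, P.map (Z j) = μ) {ε : ℝ} (hε : 0 < ε) :
    ∃ η > 0, ∀ᵐ ω ∂P, ∀ᶠ n : ℕ in atTop, ∀ t : E, ‖t‖ ≤ Real.exp (η * n) →
      ‖ecf n (fun j => Z j ω) t - charFun μ t‖ ≤ ε := by
  -- Error budget: `ε / 4` for the oscillation of each of the empirical and true functions, `ε / 2`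
  -- at the net points.
  obtain ⟨δ, hδ, hδε⟩ := exists_integral_min_two_mul_norm_lt μ (by positivity : 0 < ε / 4)
  obtain ⟨C, hC, hcover⟩ := exists_finset_cover_closedBall E hδ
  set d := Module.finrank ℝ E
  set c : ℝ := (ε / 2) ^ 2 / 8 with hc
  have hc0 : 0 < c := by positivity
  -- The net then costs at most a factor `C * exp (c * n / 2)` against the Hoeffding factor `exp (-c
  -- * n)`, leaving a summable geometric series.
  set η : ℝ := c / (2 * (d + 1)) with hη
  have hη0 : 0 < η := by positivity
  have hηd : η * d ≤ c / 2 := by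
    rw [hη, div_mul_eq_mul_div, div_le_div_iff₀ (by positivity) (by positivity)]
    nlinarith
  refine ⟨η, hη0, ?_⟩
  choose s hs_card hs using fun n : ℕ =>
    hcover (Real.exp (η * n)) (Real.one_le_exp (by positivity))
  have hmean : ∀ᵐ ω ∂P, Tendsto (fun n : ℕ =>
      (∑ j ∈ Finset.range n, min 2 (δ * ‖Z j ω‖)) / n) atTop (𝓝 (∫ z, min 2 (δ * ‖z‖) ∂μ)) := by
    have hg : Continuous fun z : E => min 2 (δ * ‖z‖) := by fun_prop
    have hint : Integrable ((fun z : E => min 2 (δ * ‖z‖)) ∘ Z 0) P := by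
      refine Integrable.comp_aemeasurable ?_ (hZ 0)
      rw [hlaw 0]
      exact integrable_min_two_mul_norm μ hδ.le
    have h := strong_law_ae_real (μ := P) (fun j => (fun z : E => min 2 (δ * ‖z‖)) ∘ Z j) hint
      (fun i j hij => (hind.indepFun hij).comp hg.measurable hg.measurable)
      (fun i => (IdentDistrib.mk (hZ i) (hZ 0) ((hlaw i).trans (hlaw 0).symm)).comp hg.measurable)
    have hm : P[(fun z : E => min 2 (δ * ‖z‖)) ∘ Z 0] = ∫ z, min 2 (δ * ‖z‖) ∂μ := by
      rw [← hlaw 0, integral_map (hZ 0) hg.aestronglyMeasurable]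
      rfl
    rw [hm] at h
    exact h
  have hnet : ∀ᵐ ω ∂P, ∀ᶠ n : ℕ in atTop, ω ∉ {ω | 0 < n ∧ ∃ u ∈ s n,
      ε / 2 ≤ ‖ecf n (fun j => Z j ω) u - charFun μ u‖} := by
    refine ae_eventually_notMem ?_
    have hbound : ∀ n : ℕ, P {ω | 0 < n ∧ ∃ u ∈ s n,
        ε / 2 ≤ ‖ecf n (fun j => Z j ω) u - charFun μ u‖} ≤
        ENNReal.ofReal (4 * C * Real.exp (-(c / 2)) ^ n) := by
      intro n
      rcases n.eq_zero_or_pos with rfl | hn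
      · simp
      rw [ENNReal.le_ofReal_iff_toReal_le (measure_ne_top _ _) (by positivity)]
      calc P.real {ω | 0 < n ∧ ∃ u ∈ s n, ε / 2 ≤ ‖ecf n (fun j => Z j ω) u - charFun μ u‖}
          ≤ P.real (⋃ u ∈ s n, {ω | ε / 2 ≤ ‖ecf n (fun j => Z j ω) u - charFun μ u‖}) := by
            refine measureReal_mono (fun ω hω => ?_) (measure_ne_top _ _)
            simpa using hω.2
        _ ≤ ∑ u ∈ s n, P.real {ω | ε / 2 ≤ ‖ecf n (fun j => Z j ω) u - charFun μ u‖} :=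
            measureReal_biUnion_finset_le _ _
        _ ≤ ∑ _u ∈ s n, 4 * Real.exp (-(c * n)) := Finset.sum_le_sum fun u _ =>
            measureReal_norm_ecf_sub_charFun_ge_le hZ hind hlaw (by positivity) u n hn
        _ = (s n).card * (4 * Real.exp (-(c * n))) := by simp
        _ ≤ C * Real.exp (η * n) ^ d * (4 * Real.exp (-(c * n))) := by
            gcongr
            exact hs_card n
        _ = 4 * C * Real.exp ((η * d) * n - c * n) := by
            rw [← Real.exp_nat_mul, sub_eq_add_neg, Real.exp_add,
              show (d : ℝ) * (η * n) = η * d * n by ring]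
            ring
        _ ≤ 4 * C * Real.exp (-(c / 2)) ^ n := by
            rw [← Real.exp_nat_mul]
            have hle : η * d * n ≤ c / 2 * n := by gcongr
            gcongr
            linarith
    refine ne_top_of_le_ne_top ?_ (ENNReal.tsum_le_tsum hbound)
    refine Summable.tsum_ofReal_ne_top (Summable.mul_left _ ?_)
    exact summable_geometric_of_lt_one (Real.exp_pos _).le (by simpa using hc0)
  filter_upwards [hmean, hnet] with ω h1 h2
  filter_upwards [h1.eventually (gt_mem_nhds hδε), h2, eventually_gt_atTop 0] with n h3 h4 hn t ht
  obtain ⟨u, hu, htu⟩ := hs n t ht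
  have h5 : ‖ecf n (fun j => Z j ω) u - charFun μ u‖ < ε / 2 := by
    by_contra! hcon
    exact h4 ⟨hn, u, hu, hcon⟩
  have h6 := norm_ecf_sub_le htu n (fun j => Z j ω)
  have h7 := norm_charFun_sub_le μ htu
  rw [norm_sub_rev] at h7
  calc _ = ‖(ecf n (fun j => Z j ω) t - ecf n (fun j => Z j ω) u) +
        (ecf n (fun j => Z j ω) u - charFun μ u) + (charFun μ u - charFun μ t)‖ := by
        congr 1
        ring
    _ ≤ _ := norm_add₃_le
    _ ≤ ε := by linarith

/-- Almost sure uniform convergence of the empirical characteristic function over the balls of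
radius `R / h n`, when `log (h n) / n → 0`. -/
lemma ae_eventually_norm_ecf_sub_charFun_le (hZ : ∀ j, AEMeasurable (Z j) P)
    (hind : iIndepFun Z P) (hlaw : ∀ j, P.map (Z j) = μ) {h : ℕ → ℝ}
    (hpos : ∀ n, 1 ≤ n → 0 < h n)
    (hlog : Tendsto (fun n : ℕ => Real.log (h n) / (n : ℝ)) atTop (𝓝 0)) :
    ∀ᵐ ω ∂P, ∀ R : ℝ, ∀ ε > 0, ∀ᶠ n : ℕ in atTop, ∀ t : E, ‖h n • t‖ ≤ R →
      ‖ecf n (fun j => Z j ω) t - charFun μ t‖ ≤ ε := by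
  -- Countably many tolerances `1 / (k + 1)` give a single null set valid for all `R` and `ε`.
  choose η hη hae using fun k : ℕ => exists_rate_ae_eventually_norm_ecf_sub_charFun_le
    (μ := μ) hZ hind hlaw (Nat.one_div_pos_of_nat (α := ℝ) (n := k))
  filter_upwards [ae_all_iff.2 hae] with ω hω R ε hε
  obtain ⟨k, hk⟩ := exists_nat_one_div_lt hε
  have h1 : Tendsto (fun n : ℕ => Real.log (max R 1) / (n : ℝ) - Real.log (h n) / n) atTop
      (𝓝 0) := by
    simpa using (tendsto_const_div_atTop_nhds_zero_nat (Real.log (max R 1))).sub hlog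
  filter_upwards [hω k, h1.eventually (gt_mem_nhds (hη k)), eventually_ge_atTop 1] with
    n h2 h3 hn t ht
  refine (h2 t ?_).trans hk.le
  have hn' : (0 : ℝ) < n := by exact_mod_cast hn
  have hh := hpos n hn
  rw [← sub_div, div_lt_iff₀ hn', ← Real.log_div (by positivity) hh.ne'] at h3
  rw [norm_smul, Real.norm_of_nonneg hh.le] at ht
  calc ‖t‖ ≤ max R 1 / h n := by
        rw [le_div_iff₀ hh, mul_comm]
        exact ht.trans (le_max_left _ _)
    _ = Real.exp (Real.log (max R 1 / h n)) := (Real.exp_log (by positivity)).symm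
    _ ≤ _ := Real.exp_le_exp.2 h3.le

end Concentration

/-! ### Smoothing functions and comparison of suprema -/

section SmoothingFunctions

variable {E : Type*} [NormedAddCommGroup E] [InnerProductSpace ℝ E] [FiniteDimensional ℝ E]
  [MeasurableSpace E] [BorelSpace E] {ξ : E → ℂ}

lemma IsContinuousCF.norm_le_one (hξ : IsContinuousCF ξ) (t : E) : ‖ξ t‖ ≤ 1 := by
  obtain ⟨μ, _, -, rfl⟩ := hξ
  exact norm_charFun_le_one t

lemma IsContinuousCF.apply_zero (hξ : IsContinuousCF ξ) : ξ 0 = 1 := by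
  obtain ⟨μ, _, -, rfl⟩ := hξ
  simp

lemma IsContinuousCF.continuous (hξ : IsContinuousCF ξ) : Continuous ξ := by
  obtain ⟨μ, _, -, rfl⟩ := hξ
  exact continuous_charFun

lemma IsContinuousCF.tendsto_cocompact (hξ : IsContinuousCF ξ) :
    Tendsto ξ (cocompact E) (𝓝 0) := by
  obtain ⟨μ, _, hμ, rfl⟩ := hξ
  exact tendsto_charFun_cocompact μ hμ

end SmoothingFunctions

lemma exists_forall_lt_norm_imp_norm_le {E : Type*} [NormedAddCommGroup E] [ProperSpace E]
    {f : E → ℂ} (hf : Tendsto f (cocompact E) (𝓝 0)) {ε : ℝ} (hε : 0 < ε) :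
    ∃ R : ℝ, ∀ t, R < ‖t‖ → ‖f t‖ ≤ ε := by
  have h1 : ∀ᶠ t in cocompact E, ‖f t‖ < ε := by
    simpa using (hf.norm).eventually (gt_mem_nhds (by simpa using hε))
  rw [← Metric.cobounded_eq_cocompact, ← comap_norm_atTop, eventually_comap, eventually_atTop] at h1
  obtain ⟨R, hR⟩ := h1
  exact ⟨R, fun t ht => (hR ‖t‖ ht.le t rfl).le⟩

/-- Only the upper bound has to be uniform: for the lower one it is enough to follow a single
near-maximizer of `‖F‖`, chosen before `n`. -/
lemma abs_iSup_norm_sub_tendsto_zero {ι : Type*} [Nonempty ι] {F : ι → ℂ} {G : ℕ → ι → ℂ}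
    (hF : BddAbove (Set.range fun p => ‖F p‖))
    (hG : ∀ n, BddAbove (Set.range fun p => ‖G n p‖))
    (hle : ∀ ε > 0, ∀ᶠ n in atTop, ∀ p, ‖G n p‖ ≤ ‖F p‖ + ε)
    (hge : ∀ p, ∀ ε > 0, ∀ᶠ n in atTop, ‖F p‖ - ε ≤ ‖G n p‖) :
    Tendsto (fun n => |(⨆ p, ‖F p‖) - ⨆ p, ‖G n p‖|) atTop (𝓝 0) := by
  rw [Metric.tendsto_nhds]
  intro ε hε
  obtain ⟨p, hp⟩ := exists_lt_of_lt_ciSup (show (⨆ p, ‖F p‖) - ε / 4 < ⨆ p, ‖F p‖ by linarith)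
  filter_upwards [hle (ε / 2) (by positivity), hge p (ε / 4) (by positivity)] with n h1 h2
  have h3 : ⨆ p, ‖G n p‖ ≤ (⨆ p, ‖F p‖) + ε / 2 :=
    ciSup_le fun q => (h1 q).trans (by gcongr; exact le_ciSup hF q)
  have h4 := le_ciSup (hG n) p
  rw [Real.dist_eq, sub_zero, abs_abs, abs_lt]
  constructor <;> linarith

lemma norm_sub_mul_sub_le {a b c a' b' c' : ℂ} {ε : ℝ} (ha : ‖a - a'‖ ≤ ε) (hb : ‖b - b'‖ ≤ ε)
    (hc : ‖c - c'‖ ≤ ε) (hb1 : ‖b‖ ≤ 1) (hc1 : ‖c'‖ ≤ 1) :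
    ‖(a - b * c) - (a' - b' * c')‖ ≤ 3 * ε := by
  have h : (a - b * c) - (a' - b' * c') = (a - a') + -(b * (c - c')) + -((b - b') * c') := by ring
  rw [h]
  refine norm_add₃_le.trans ?_
  rw [norm_neg, norm_neg, norm_mul, norm_mul]
  have h1 : ‖b‖ * ‖c - c'‖ ≤ 1 * ε := by gcongr
  have h2 : ‖b - b'‖ * ‖c'‖ ≤ ε * 1 := by
    gcongr
    exact (norm_nonneg _).trans ha
  linarith

lemma norm_sub_mul_le_two {a b c : ℂ} (ha : ‖a‖ ≤ 1) (hb : ‖b‖ ≤ 1) (hc : ‖c‖ ≤ 1) :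
    ‖a - b * c‖ ≤ 2 := by
  refine (norm_sub_le _ _).trans ?_
  rw [norm_mul]
  have : ‖b‖ * ‖c‖ ≤ 1 * 1 := by gcongr
  linarith

/-! ### Uniform convergence of smoothed empirical characteristic functions -/

section Smoothing

variable {E : Type*} [NormedAddCommGroup E] [InnerProductSpace ℝ E] [FiniteDimensional ℝ E]
  [MeasurableSpace E] [BorelSpace E] {ξ φ : E → ℂ} {z : ℕ → E} {h : ℕ → ℝ}

lemma norm_smoothedEcf_le_one (hξ : IsContinuousCF ξ) (n : ℕ) (z : ℕ → E) (r : ℝ) (t : E) :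
    ‖smoothedEcf ξ n z r t‖ ≤ 1 := by
  rw [smoothedEcf, norm_mul]
  exact mul_le_one₀ (norm_ecf_le_one _ _ _) (norm_nonneg _) (hξ.norm_le_one _)

/-- When the limit vanishes at infinity, the smoothed empirical characteristic function converges
to it uniformly. -/
lemma eventually_norm_smoothedEcf_sub_le (hξ : IsContinuousCF ξ) (hφ1 : ∀ t, ‖φ t‖ ≤ 1)
    (hφ : Tendsto φ (cocompact E) (𝓝 0)) (hlim : Tendsto h atTop (𝓝 0))
    (hz : ∀ R : ℝ, ∀ ε > 0, ∀ᶠ n : ℕ in atTop, ∀ t : E, ‖h n • t‖ ≤ R →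
      ‖ecf n z t - φ t‖ ≤ ε) {ε : ℝ} (hε : 0 < ε) :
    ∀ᶠ n : ℕ in atTop, ∀ t, ‖smoothedEcf ξ n z (h n) t - φ t‖ ≤ ε := by
  -- Where `ξ` is small, the other factor is only known to be at most 2, hence `ε / 6`.
  obtain ⟨R, hR⟩ := exists_forall_lt_norm_imp_norm_le hξ.tendsto_cocompact
    (by positivity : 0 < ε / 6)
  obtain ⟨M, hM⟩ := exists_forall_lt_norm_imp_norm_le hφ (by positivity : 0 < ε / 3)
  obtain ⟨δ, hδ, hξδ⟩ := Metric.continuousAt_iff.1 (hξ.continuous.continuousAt (x := 0)) (ε / 3)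
    (by positivity)
  have hsmall : ∀ᶠ n in atTop, |h n| * (|M| + 1) < δ := by
    have := hlim.abs.mul_const (|M| + 1)
    simp only [abs_zero, zero_mul] at this
    exact this.eventually (gt_mem_nhds hδ)
  filter_upwards [hz R (ε / 3) (by positivity), hsmall] with n h1 h2 t
  -- Smoothing bias: for large `t` the limit `φ` is small; on the remaining fixed ball `h n • t` is
  -- near 0, where `ξ` is near 1.
  have hb : ‖φ t‖ * ‖ξ (h n • t) - 1‖ ≤ 2 * (ε / 3) := by
    by_cases ht : M < ‖t‖
    · have : ‖ξ (h n • t) - 1‖ ≤ 2 := by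
        refine (norm_sub_le _ _).trans ?_
        rw [norm_one]
        linarith [hξ.norm_le_one (h n • t)]
      calc _ ≤ ε / 3 * 2 := by
            gcongr
            exact hM t ht
        _ = _ := by ring
    · have h3 : dist (h n • t) 0 < δ := by
        rw [dist_zero_right, norm_smul, Real.norm_eq_abs]
        refine lt_of_le_of_lt ?_ h2
        gcongr
        linarith [le_abs_self M]
      have h4 := hξδ h3
      rw [hξ.apply_zero, dist_eq_norm] at h4
      calc _ ≤ 1 * (ε / 3) := by
            gcongr
            exact hφ1 t
        _ ≤ _ := by linarith
  have hin : ‖ecf n z t - φ t‖ * ‖ξ (h n • t)‖ ≤ ε / 3 := by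
    by_cases ht : ‖h n • t‖ ≤ R
    · calc _ ≤ ε / 3 * 1 := by
            gcongr
            · exact h1 t ht
            · exact hξ.norm_le_one _
        _ = _ := mul_one _
    · have h3 : ‖ecf n z t - φ t‖ ≤ 2 :=
        (norm_sub_le _ _).trans (by linarith [norm_ecf_le_one n z t, hφ1 t])
      calc _ ≤ 2 * (ε / 6) := by
            gcongr
            exact hR _ (not_le.1 ht)
        _ = _ := by ring
  have heq : smoothedEcf ξ n z (h n) t - φ t =
      (ecf n z t - φ t) * ξ (h n • t) + φ t * (ξ (h n • t) - 1) := by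
    rw [smoothedEcf]
    ring
  rw [heq]
  refine (norm_add_le _ _).trans ?_
  rw [norm_mul, norm_mul]
  linarith

end Smoothing

/-! ### Joint vectors and marginals -/

section JoinVec

variable {dX dY : ℕ}

lemma norm_le_norm_joinVec_left (α : EuclideanSpace ℝ (Fin dX)) (β : EuclideanSpace ℝ (Fin dY)) :
    ‖α‖ ≤ ‖joinVec α β‖ := by
  refine le_of_sq_le_sq ?_ (norm_nonneg _)
  rw [WithLp.prod_norm_sq_eq_of_L2]
  exact le_add_of_nonneg_right (sq_nonneg _)

lemma norm_le_norm_joinVec_right (α : EuclideanSpace ℝ (Fin dX)) (β : EuclideanSpace ℝ (Fin dY)) :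
    ‖β‖ ≤ ‖joinVec α β‖ := by
  refine le_of_sq_le_sq ?_ (norm_nonneg _)
  rw [WithLp.prod_norm_sq_eq_of_L2]
  exact le_add_of_nonneg_left (sq_nonneg _)

lemma smul_joinVec (r : ℝ) (α : EuclideanSpace ℝ (Fin dX)) (β : EuclideanSpace ℝ (Fin dY)) :
    r • joinVec α β = joinVec (r • α) (r • β) := rfl

lemma measurable_uncurry_joinVec :
    Measurable fun p : EuclideanSpace ℝ (Fin dX) × EuclideanSpace ℝ (Fin dY) =>
      joinVec p.1 p.2 :=
  WithLp.measurable_toLp 2 _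

lemma norm_joinVec_zero_right (α : EuclideanSpace ℝ (Fin dX)) :
    ‖joinVec α (0 : EuclideanSpace ℝ (Fin dY))‖ = ‖α‖ := by
  simp [joinVec]

lemma norm_joinVec_zero_left (β : EuclideanSpace ℝ (Fin dY)) :
    ‖joinVec (0 : EuclideanSpace ℝ (Fin dX)) β‖ = ‖β‖ := by
  simp [joinVec]

variable {Ω : Type*} [MeasurableSpace Ω] {P : Measure Ω}
  {X : Ω → EuclideanSpace ℝ (Fin dX)} {Y : Ω → EuclideanSpace ℝ (Fin dY)}

lemma aemeasurable_joinVec (hX : AEMeasurable X P) (hY : AEMeasurable Y P) :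
    AEMeasurable (fun ω => joinVec (X ω) (Y ω)) P :=
  measurable_uncurry_joinVec.comp_aemeasurable (hX.prodMk hY)

lemma cf_eq_integral {E : Type*} [NormedAddCommGroup E] [InnerProductSpace ℝ E]
    [MeasurableSpace E] [BorelSpace E] {Z : Ω → E} (hZ : AEMeasurable Z P) (t : E)
    [SecondCountableTopology E] :
    cf P Z t = ∫ ω, Complex.exp (((inner ℝ (Z ω) t : ℝ) : ℂ) * Complex.I) ∂P := by
  rw [cf, charFun_apply, integral_map hZ]
  exact Continuous.aestronglyMeasurable (by fun_prop)

lemma cf_joinVec_zero_right (hX : AEMeasurable X P) (hY : AEMeasurable Y P)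
    (α : EuclideanSpace ℝ (Fin dX)) :
    cf P (fun ω => joinVec (X ω) (Y ω)) (joinVec α 0) = cf P X α := by
  rw [cf_eq_integral (aemeasurable_joinVec hX hY), cf_eq_integral hX]
  simp [joinVec]

lemma cf_joinVec_zero_left (hX : AEMeasurable X P) (hY : AEMeasurable Y P)
    (β : EuclideanSpace ℝ (Fin dY)) :
    cf P (fun ω => joinVec (X ω) (Y ω)) (joinVec 0 β) = cf P Y β := by
  rw [cf_eq_integral (aemeasurable_joinVec hX hY), cf_eq_integral hY]
  simp [joinVec]

lemma norm_cf_le_one [IsProbabilityMeasure P] {E : Type*} [NormedAddCommGroup E]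
    [InnerProductSpace ℝ E] [MeasurableSpace E] {Z : Ω → E} (hZ : AEMeasurable Z P) (t : E) :
    ‖cf P Z t‖ ≤ 1 :=
  have := Measure.isProbabilityMeasure_map hZ
  norm_charFun_le_one t

/-- Applied to `α ↦ (α, 0)` and `β ↦ (0, β)`, it passes decay at infinity from the joint
characteristic function to the marginals. -/
lemma tendsto_cocompact_comp_of_norm_eq {E F : Type*} [NormedAddCommGroup E] [ProperSpace E]
    [NormedAddCommGroup F] [ProperSpace F] {f : F → ℂ} (hf : Tendsto f (cocompact F) (𝓝 0))
    {g : E → F} (hg : ∀ t, ‖g t‖ = ‖t‖) : Tendsto (fun t => f (g t)) (cocompact E) (𝓝 0) := by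
  refine hf.comp ?_
  rw [← Metric.cobounded_eq_cocompact, ← Metric.cobounded_eq_cocompact,
    ← tendsto_norm_atTop_iff_cobounded]
  simp_rw [hg]
  exact tendsto_norm_cobounded_atTop

end JoinVec

/-! ### Consistency of the smoothed estimator -/

section KacIM

variable {Ω : Type*} [MeasurableSpace Ω] {P : Measure Ω} [IsProbabilityMeasure P] {dX dY : ℕ}
  {X : Ω → EuclideanSpace ℝ (Fin dX)} {Y : Ω → EuclideanSpace ℝ (Fin dY)}
  {ξX : EuclideanSpace ℝ (Fin dX) → ℂ} {ξY : EuclideanSpace ℝ (Fin dY) → ℂ}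
  {ξXY : WithLp 2 (EuclideanSpace ℝ (Fin dX) × EuclideanSpace ℝ (Fin dY)) → ℂ}
  {x : ℕ → EuclideanSpace ℝ (Fin dX)} {y : ℕ → EuclideanSpace ℝ (Fin dY)} {h : ℕ → ℝ}

lemma norm_kacDelta_le_two (hX : AEMeasurable X P) (hY : AEMeasurable Y P)
    (α : EuclideanSpace ℝ (Fin dX)) (β : EuclideanSpace ℝ (Fin dY)) :
    ‖kacDelta P X Y α β‖ ≤ 2 :=
  norm_sub_mul_le_two (norm_cf_le_one (aemeasurable_joinVec hX hY) _) (norm_cf_le_one hX _)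
    (norm_cf_le_one hY _)

lemma norm_smoothedDelta_le_two (hξX : IsContinuousCF ξX) (hξY : IsContinuousCF ξY)
    (hξXY : IsContinuousCF ξXY) (n : ℕ) (r : ℝ)
    (α : EuclideanSpace ℝ (Fin dX)) (β : EuclideanSpace ℝ (Fin dY)) :
    ‖smoothedDelta ξX ξY ξXY n x y r α β‖ ≤ 2 :=
  norm_sub_mul_le_two (norm_smoothedEcf_le_one hξXY _ _ _ _) (norm_smoothedEcf_le_one hξX _ _ _ _)
    (norm_smoothedEcf_le_one hξY _ _ _ _)

/-- With compatible smoothing functions the smoothed empirical `Δ` is uniformly close to the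
smoothed `Δ`. -/
lemma eventually_norm_smoothedDelta_sub_mul_kacDelta_le (hX : AEMeasurable X P)
    (hY : AEMeasurable Y P) (hξXY : IsContinuousCF ξXY)
    (hξ : ∀ α β, ξXY (joinVec α β) = ξX α * ξY β)
    (hx : ∀ R : ℝ, ∀ ε > 0, ∀ᶠ n : ℕ in atTop, ∀ t, ‖h n • t‖ ≤ R → ‖ecf n x t - cf P X t‖ ≤ ε)
    (hy : ∀ R : ℝ, ∀ ε > 0, ∀ᶠ n : ℕ in atTop, ∀ t, ‖h n • t‖ ≤ R → ‖ecf n y t - cf P Y t‖ ≤ ε)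
    (hxy : ∀ R : ℝ, ∀ ε > 0, ∀ᶠ n : ℕ in atTop, ∀ t, ‖h n • t‖ ≤ R →
      ‖ecf n (fun j => joinVec (x j) (y j)) t - cf P (fun ω => joinVec (X ω) (Y ω)) t‖ ≤ ε)
    {ε : ℝ} (hε : 0 < ε) :
    ∀ᶠ n : ℕ in atTop, ∀ p : EuclideanSpace ℝ (Fin dX) × EuclideanSpace ℝ (Fin dY),
      ‖smoothedDelta ξX ξY ξXY n x y (h n) p.1 p.2 -
        ξXY (h n • joinVec p.1 p.2) * kacDelta P X Y p.1 p.2‖ ≤ ε := by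
  -- Empirical and true Δ are each bounded by 2, so their difference by 4.
  obtain ⟨R, hR⟩ := exists_forall_lt_norm_imp_norm_le hξXY.tendsto_cocompact
    (by positivity : 0 < ε / 4)
  filter_upwards [hx R (ε / 3) (by positivity), hy R (ε / 3) (by positivity),
    hxy R (ε / 3) (by positivity)] with n h1 h2 h3 ⟨α, β⟩
  have heq : smoothedDelta ξX ξY ξXY n x y (h n) α β -
      ξXY (h n • joinVec α β) * kacDelta P X Y α β = ξXY (h n • joinVec α β) *
      ((ecf n (fun j => joinVec (x j) (y j)) (joinVec α β) - ecf n x α * ecf n y β) -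
        (cf P (fun ω => joinVec (X ω) (Y ω)) (joinVec α β) - cf P X α * cf P Y β)) := by
    rw [smoothedDelta, kacDelta, smoothedEcf, smoothedEcf, smoothedEcf, smul_joinVec, hξ]
    ring
  rw [heq, norm_mul]
  by_cases hp : ‖h n • joinVec α β‖ ≤ R
  · have hp' := hp
    rw [smul_joinVec] at hp'
    have := norm_sub_mul_sub_le (h3 _ hp) (h1 α ((norm_le_norm_joinVec_left _ _).trans hp'))
      (h2 β ((norm_le_norm_joinVec_right _ _).trans hp')) (norm_ecf_le_one n x α)
      (norm_cf_le_one hY β)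
    calc _ ≤ 1 * (3 * (ε / 3)) := by
          gcongr
          exact hξXY.norm_le_one _
      _ = ε := by ring
  · have h4 : ‖ecf n (fun j => joinVec (x j) (y j)) (joinVec α β) - ecf n x α * ecf n y β‖ ≤ 2 :=
      norm_sub_mul_le_two (norm_ecf_le_one _ _ _) (norm_ecf_le_one _ _ _) (norm_ecf_le_one _ _ _)
    have h5 := norm_kacDelta_le_two hX hY α β
    rw [kacDelta] at h5
    calc _ ≤ ε / 4 * (2 + 2) := by
          gcongr
          · exact hR _ (not_le.1 hp)
          · exact (norm_sub_le _ _).trans (add_le_add h4 h5)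
      _ = ε := by ring

/-- When the joint characteristic function vanishes at infinity the smoothed empirical `Δ`
converges uniformly to `Δ`. -/
lemma eventually_norm_smoothedDelta_sub_kacDelta_le (hX : AEMeasurable X P)
    (hY : AEMeasurable Y P) (hξX : IsContinuousCF ξX) (hξY : IsContinuousCF ξY)
    (hξXY : IsContinuousCF ξXY)
    (hφ : Tendsto (cf P fun ω => joinVec (X ω) (Y ω)) (cocompact _) (𝓝 0))
    (hlim : Tendsto h atTop (𝓝 0))
    (hx : ∀ R : ℝ, ∀ ε > 0, ∀ᶠ n : ℕ in atTop, ∀ t, ‖h n • t‖ ≤ R → ‖ecf n x t - cf P X t‖ ≤ ε)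
    (hy : ∀ R : ℝ, ∀ ε > 0, ∀ᶠ n : ℕ in atTop, ∀ t, ‖h n • t‖ ≤ R → ‖ecf n y t - cf P Y t‖ ≤ ε)
    (hxy : ∀ R : ℝ, ∀ ε > 0, ∀ᶠ n : ℕ in atTop, ∀ t, ‖h n • t‖ ≤ R →
      ‖ecf n (fun j => joinVec (x j) (y j)) t - cf P (fun ω => joinVec (X ω) (Y ω)) t‖ ≤ ε)
    {ε : ℝ} (hε : 0 < ε) :
    ∀ᶠ n : ℕ in atTop, ∀ p : EuclideanSpace ℝ (Fin dX) × EuclideanSpace ℝ (Fin dY),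
      ‖smoothedDelta ξX ξY ξXY n x y (h n) p.1 p.2 - kacDelta P X Y p.1 p.2‖ ≤ ε := by
  have hφX : Tendsto (cf P X) (cocompact _) (𝓝 0) :=
    (tendsto_cocompact_comp_of_norm_eq hφ norm_joinVec_zero_right).congr
      (cf_joinVec_zero_right hX hY)
  have hφY : Tendsto (cf P Y) (cocompact _) (𝓝 0) :=
    (tendsto_cocompact_comp_of_norm_eq hφ norm_joinVec_zero_left).congr
      (cf_joinVec_zero_left hX hY)
  have hε3 : 0 < ε / 3 := by positivity
  filter_upwards [
    eventually_norm_smoothedEcf_sub_le hξX (norm_cf_le_one hX) hφX hlim hx hε3,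
    eventually_norm_smoothedEcf_sub_le hξY (norm_cf_le_one hY) hφY hlim hy hε3,
    eventually_norm_smoothedEcf_sub_le hξXY (norm_cf_le_one (aemeasurable_joinVec hX hY)) hφ hlim
      hxy hε3] with n h1 h2 h3 p
  refine (norm_sub_mul_sub_le (h3 _) (h1 _) (h2 _) (norm_smoothedEcf_le_one hξX _ _ _ _)
    (norm_cf_le_one hY _)).trans ?_
  linarith

/-- The smoothed estimator is consistent along every sequence of observations whose empirical
characteristic functions converge uniformly on the balls of radius `R / h n`. -/
lemma tendsto_abs_kacIM_sub_smoothedKacIM (hX : AEMeasurable X P) (hY : AEMeasurable Y P)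
    (hξX : IsContinuousCF ξX) (hξY : IsContinuousCF ξY) (hξXY : IsContinuousCF ξXY)
    (hξ : (∀ α β, ξXY (joinVec α β) = ξX α * ξY β) ∨
      Tendsto (cf P fun ω => joinVec (X ω) (Y ω)) (cocompact _) (𝓝 0))
    (hlim : Tendsto h atTop (𝓝 0))
    (hx : ∀ R : ℝ, ∀ ε > 0, ∀ᶠ n : ℕ in atTop, ∀ t, ‖h n • t‖ ≤ R → ‖ecf n x t - cf P X t‖ ≤ ε)
    (hy : ∀ R : ℝ, ∀ ε > 0, ∀ᶠ n : ℕ in atTop, ∀ t, ‖h n • t‖ ≤ R → ‖ecf n y t - cf P Y t‖ ≤ ε)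
    (hxy : ∀ R : ℝ, ∀ ε > 0, ∀ᶠ n : ℕ in atTop, ∀ t, ‖h n • t‖ ≤ R →
      ‖ecf n (fun j => joinVec (x j) (y j)) t - cf P (fun ω => joinVec (X ω) (Y ω)) t‖ ≤ ε) :
    Tendsto (fun n : ℕ => |kacIM P X Y - smoothedKacIM ξX ξY ξXY n x y (h n)|) atTop (𝓝 0) := by
  refine abs_iSup_norm_sub_tendsto_zero ⟨2, ?_⟩ (fun n => ⟨2, ?_⟩) ?_ ?_
  · rintro _ ⟨p, rfl⟩
    exact norm_kacDelta_le_two hX hY _ _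
  · rintro _ ⟨p, rfl⟩
    exact norm_smoothedDelta_le_two hξX hξY hξXY _ _ _ _
  all_goals rcases hξ with hξ | hξ
  · intro ε hε
    filter_upwards [eventually_norm_smoothedDelta_sub_mul_kacDelta_le hX hY hξXY hξ hx hy hxy hε]
      with n hn p
    have h1 := norm_sub_norm_le (smoothedDelta ξX ξY ξXY n x y (h n) p.1 p.2)
      (ξXY (h n • joinVec p.1 p.2) * kacDelta P X Y p.1 p.2)
    have h2 : ‖ξXY (h n • joinVec p.1 p.2) * kacDelta P X Y p.1 p.2‖ ≤
        ‖kacDelta P X Y p.1 p.2‖ := by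
      rw [norm_mul]
      exact mul_le_of_le_one_left (norm_nonneg _) (hξXY.norm_le_one _)
    linarith [hn p]
  · intro ε hε
    filter_upwards [eventually_norm_smoothedDelta_sub_kacDelta_le hX hY hξX hξY hξXY hξ hlim hx hy
      hxy hε] with n hn p
    have h1 := norm_sub_norm_le (smoothedDelta ξX ξY ξXY n x y (h n) p.1 p.2)
      (kacDelta P X Y p.1 p.2)
    linarith [hn p]
  · intro p ε hε
    -- Here the frequency is fixed, so continuity of `ξXY` at 0 undoes the smoothing in the limit.
    have hcont : Tendsto (fun n => ‖ξXY (h n • joinVec p.1 p.2) * kacDelta P X Y p.1 p.2‖) atTop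
        (𝓝 ‖kacDelta P X Y p.1 p.2‖) := by
      have h1 := hlim.smul_const (joinVec p.1 p.2)
      have h2 := (((hξXY.continuous.tendsto _).comp h1).mul_const (kacDelta P X Y p.1 p.2)).norm
      rw [zero_smul, hξXY.apply_zero, one_mul] at h2
      exact h2
    filter_upwards [eventually_norm_smoothedDelta_sub_mul_kacDelta_le hX hY hξXY hξ hx hy hxy
      (half_pos hε), hcont.eventually
        (lt_mem_nhds (show ‖kacDelta P X Y p.1 p.2‖ - ε / 2 < _ by linarith))] with n hn h3
    have h4 := norm_sub_norm_le (ξXY (h n • joinVec p.1 p.2) * kacDelta P X Y p.1 p.2)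
      (smoothedDelta ξX ξY ξXY n x y (h n) p.1 p.2)
    rw [norm_sub_rev] at h4
    linarith [hn p]
  · intro p ε hε
    filter_upwards [eventually_norm_smoothedDelta_sub_kacDelta_le hX hY hξX hξY hξXY hξ hlim hx hy
      hxy hε] with n hn
    have h1 := norm_sub_norm_le (kacDelta P X Y p.1 p.2)
      (smoothedDelta ξX ξY ξXY n x y (h n) p.1 p.2)
    rw [norm_sub_rev] at h1
    linarith [hn p]

end KacIM

theorem corollary3 {Ω Ω' : Type*} [MeasurableSpace Ω] [MeasurableSpace Ω']
    (P : Measure Ω) [IsProbabilityMeasure P] (P' : Measure Ω') [IsProbabilityMeasure P']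
    {dX dY : ℕ}
    (X : Ω' → EuclideanSpace ℝ (Fin dX)) (Y : Ω' → EuclideanSpace ℝ (Fin dY))
    (hX : AEMeasurable X P') (hY : AEMeasurable Y P')
    (x : ℕ → Ω → EuclideanSpace ℝ (Fin dX)) (y : ℕ → Ω → EuclideanSpace ℝ (Fin dY))
    (hindep : iIndepFun (fun j ω => (x j ω, y j ω)) P)
    (hident : ∀ j, IdentDistrib (fun ω => (x j ω, y j ω)) (fun ω' => (X ω', Y ω')) P P')
    (ξX : EuclideanSpace ℝ (Fin dX) → ℂ) (ξY : EuclideanSpace ℝ (Fin dY) → ℂ)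
    (ξXY : WithLp 2 (EuclideanSpace ℝ (Fin dX) × EuclideanSpace ℝ (Fin dY)) → ℂ)
    (hξX : IsContinuousCF ξX) (hξY : IsContinuousCF ξY) (hξXY : IsContinuousCF ξXY)
    (hξ : (∀ α β, ξXY (joinVec α β) = ξX α * ξY β) ∨
      Tendsto (cf P' fun ω' => joinVec (X ω') (Y ω')) (cocompact _) (𝓝 0))
    (h : ℕ → ℝ) (hpos : ∀ n, 1 ≤ n → 0 < h n)
    (hlim : Tendsto h atTop (𝓝 0))
    (hlog : Tendsto (fun n : ℕ => Real.log (h n) / (n : ℝ)) atTop (𝓝 0)) :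
    ∀ᵐ ω ∂P, Tendsto
      (fun n : ℕ => |kacIM P' X Y -
        smoothedKacIM ξX ξY ξXY n (fun j => x j ω) (fun j => y j ω) (h n)|)
      atTop (𝓝 0) := by
  have hxm : ∀ j, AEMeasurable (x j) P := fun j =>
    measurable_fst.comp_aemeasurable (hident j).aemeasurable_fst
  have hym : ∀ j, AEMeasurable (y j) P := fun j =>
    measurable_snd.comp_aemeasurable (hident j).aemeasurable_fst
  have := Measure.isProbabilityMeasure_map hX
  have := Measure.isProbabilityMeasure_map hY
  have := Measure.isProbabilityMeasure_map (aemeasurable_joinVec hX hY)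
  have hjoin := measurable_uncurry_joinVec (dX := dX) (dY := dY)
  -- Both coordinates and the joined vectors are measurable images of the i.i.d. pairs, so the
  -- uniform estimate applies to all three samples, outside a common null set.
  filter_upwards [
    ae_eventually_norm_ecf_sub_charFun_le (μ := P'.map X) hxm (hindep.comp (fun _ => Prod.fst)
      fun _ => measurable_fst) (fun j => ((hident j).comp measurable_fst).map_eq) hpos hlog,
    ae_eventually_norm_ecf_sub_charFun_le (μ := P'.map Y) hym (hindep.comp (fun _ => Prod.snd)
      fun _ => measurable_snd) (fun j => ((hident j).comp measurable_snd).map_eq) hpos hlog,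
    ae_eventually_norm_ecf_sub_charFun_le (μ := P'.map fun ω' => joinVec (X ω') (Y ω'))
      (fun j => aemeasurable_joinVec (hxm j) (hym j))
      (hindep.comp (fun _ p => joinVec p.1 p.2) fun _ => hjoin)
      (fun j => ((hident j).comp hjoin).map_eq) hpos hlog] with ω h1 h2 h3
  exact tendsto_abs_kacIM_sub_smoothedKacIM hX hY hξX hξY hξXY hξ hlim h1 h2 h3
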